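/- For an infinite cardinal $\lambda$, say that SCH holds at $\lambda$ if $\lambda^{\operatorname{cf}(\lambda)} = 2^{\operatorname{cf}(\lambda)} + \lambda^+$. Let ESCH (the eventual singular cardinal hypothesis) be the statement that there is a cardinal $\theta_0$ such that SCH holds at every infinite cardinal $\lambda \ge \theta_0$. For a regular cardinal $\theta$, an object $M$ of a category $\mathcal K$ is $\theta$-presentable if $\operatorname{Hom}_{\mathcal K}(M,-)$ preserves $\theta$-directed colimits, and the presentability rank of $M$ is the least regular cardinal $\theta$ such that $M$ is $\theta$-presentable. The (locally small) category $\mathcal K$ is $\theta$-accessible if it has $\theta$-directed colimits, has only a set of $\theta$-presentable objects up to isomorphism, and every object is a $\theta$-directed colimit of $\theta$-presentable objects. A category is large if it has a proper class of pairwise non-isomorphic objects. **Corollary.** Assume ESCH. Let $\mathcal K$ be a large category all of whose morphisms are monomorphisms. Then there is a cardinal $\theta_0$ such that for every successor cardinal $\theta \ge \theta_0$, if $\mathcal K$ is $\theta$-accessible, then $\mathcal K$ has an object of presentability rank $\theta$. In other words, the successor cardinals in the accessibility spectrum of $\mathcal K$ (the class of regular $\theta$ such that $\mathcal K$ is $\theta$-accessible)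 are eventually contained in its existence spectrum (the class of regular $\theta$ such that $\mathcal K$ has an object of presentability rank $\theta$). -/

import Mathlib

open CategoryTheory Cardinal

universe w v u

/-- `SCH` holds at the cardinal `c`: `c ^ cf c = 2 ^ cf c + c⁺`. -/
def SCHAt (c : Cardinal.{w}) : Prop :=
  c ^ c.ord.cof = 2 ^ c.ord.cof + Order.succ c

/-- `SCH` holds above `c`: it holds at every infinite cardinal `θ ≥ c`. -/
def SCHAbove (c : Cardinal.{w}) : Prop :=
  ∀ θ : Cardinal.{w}, ℵ₀ ≤ θ → c ≤ θ → SCHAt θ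

/-- The eventual singular cardinal hypothesis, for the cardinals of the universe `w`. -/
def ESCH : Prop :=
  ∃ θ₀ : Cardinal.{w}, SCHAbove θ₀

/-- A category is large if its isomorphism classes of objects form a proper class,
where "set" means `w`-small. -/
def IsLargeCategory (K : Type u) [Category.{v} K] : Prop :=
  ¬ Small.{w} (Quotient (isIsomorphicSetoid K))

/-- The presentability rank of `M` is `θ`: `θ` is the least regular cardinal such that
`M` is `θ`-presentable. -/
def HasPresentabilityRank {K : Type u} [Category.{v} K] (M : K) (θ : Cardinal.{w}) : Prop :=
  IsLeast {κ : Cardinal.{w} | ∃ _ : Fact κ.IsRegular, IsCardinalPresentable M κ} θ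

/-- The class of regular cardinals `θ` such that `K` is `θ`-accessible. -/
def accessibilitySpectrum (K : Type u) [Category.{v} K] : Set Cardinal.{w} :=
  {θ | ∃ _ : Fact θ.IsRegular, IsCardinalAccessibleCategory K θ}

/-- The class of regular cardinals `θ` such that `K` has an object of presentability rank `θ`. -/
def existenceSpectrum (K : Type u) [Category.{v} K] : Set Cardinal.{w} :=
  {θ | ∃ M : K, HasPresentabilityRank M θ}

/-!
Let `κ` be such that `K` is `κ`-accessible. A small dense family of `κ`-presentable objects measures
the size of an object `X` by the number of its generalized elements, the morphisms from the family
to `X`. An object of size less than a large regular cardinal `θ` is `θ`-presentable, being a colimit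
of fewer than `θ` members of the family. Conversely, if `χ ^ κ = χ`, then any set of `χ` indices of
a `κ`-directed diagram is contained in a `κ`-directed set of `χ` indices. A `χ⁺`-presentable object
is therefore a retract of the colimit of `κ`-presentable objects over `χ` indices, so its size is
at most `χ`.

Let `θ = μ⁺` be large. As `K` is large, it has an object that is not `θ`-presentable; write it as a
`θ`-directed colimit of `θ`-presentable objects.

If `μ` is singular, the colimit has size at least `μ`, so some term `M` of the diagram already
has. `SCH` gives cofinally many `χ < μ` with `χ ^ κ = χ`, hence `M` is not `l`-presentable for any
`l < μ`.

If `μ` is regular, the diagram is not eventually constant, so it contains a chain of length `μ` of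
non-invertible morphisms. The colimit of this chain is `θ`-presentable. Were it `μ`-presentable, its
identity would factor through a term of the chain, and the chain would stabilize there because all
morphisms are monomorphisms.
-/

open Limits

section CardinalArithmetic

lemma mk_Iic_toType_ord_lt {κ : Cardinal.{w}} (hκ : ℵ₀ ≤ κ) (a : κ.ord.ToType) :
    #(Set.Iic a) < κ := by
  simpa using mk_Iic_lt a (by simp) (by simpa using hκ)

lemma power_le_self_of_lt_cof {κ l : Cardinal.{w}} (hκ : ℵ₀ ≤ κ) (hl : l < κ.ord.cof)
    (h : ∀ c < κ, c ^ l ≤ κ) : κ ^ l ≤ κ := by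
  have exists_bound (f : l.out → κ.ord.ToType) : ∃ a, ∀ t, f t ≤ a := by
    by_contra! hf
    have : IsCofinal (Set.range f) := fun a ↦
      let ⟨t, ht⟩ := hf a
      ⟨f t, ⟨t, rfl⟩, ht.le⟩
    refine hl.not_ge ?_
    rw [← Ordinal.cof_toType]
    exact (Order.cof_le this).trans (mk_range_le.trans (by simp))
  have surjective : Function.Surjective
      fun (x : Σ a : κ.ord.ToType, l.out → Set.Iic a) (t : l.out) ↦ (x.2 t).1 := fun f ↦
    let ⟨a, ha⟩ := exists_bound f
    ⟨⟨a, fun t ↦ ⟨f t, ha t⟩⟩, rfl⟩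
  calc κ ^ l = #(l.out → κ.ord.ToType) := by simp
    _ ≤ #(Σ a : κ.ord.ToType, l.out → Set.Iic a) := mk_le_of_surjective surjective
    _ = sum fun a : κ.ord.ToType ↦ #(Set.Iic a) ^ l := by simp [mk_sigma]
    _ ≤ sum fun _ : κ.ord.ToType ↦ κ := sum_le_sum _ _ fun a ↦ h _ (mk_Iic_toType_ord_lt hκ a)
    _ = κ := by simp [mul_eq_self hκ]

lemma power_le_power_cof {κ l : Cardinal.{w}} (hκ : ℵ₀ ≤ κ) (h : ∀ c < κ, c ^ l ≤ κ) :
    κ ^ l ≤ κ ^ κ.ord.cof := by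
  obtain ⟨S, hS, hS'⟩ := Order.exists_cof_eq κ.ord.ToType
  let truncate (f : l.out → κ.ord.ToType) (s : S) (t : l.out) : Set.Iic s.1 :=
    ⟨min (f t) s, Set.mem_Iic.2 (min_le_right _ _)⟩
  have injective : Function.Injective truncate := fun f g hfg ↦ by
    ext t
    obtain ⟨s, hs, hs'⟩ := hS (max (f t) (g t))
    have := congr_arg Subtype.val (congr_fun (congr_fun hfg ⟨s, hs⟩) t)
    simpa [truncate, min_eq_left ((le_max_left _ _).trans hs'),
      min_eq_left ((le_max_right _ _).trans hs')] using this
  calc κ ^ l = #(l.out → κ.ord.ToType) := by simp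
    _ ≤ #((s : S) → l.out → Set.Iic s.1) := mk_le_of_injective injective
    _ = Cardinal.prod fun s : S ↦ #(Set.Iic s.1) ^ l := by simp [mk_pi]
    _ ≤ Cardinal.prod fun _ : S ↦ κ := prod_le_prod _ _ fun s ↦ h _ (mk_Iic_toType_ord_lt hκ s)
    _ = κ ^ κ.ord.cof := by simp [hS', Ordinal.cof_toType]

lemma exists_le_power_le_self (m : Cardinal.{w}) {l : Cardinal.{w}} (hl : ℵ₀ ≤ l) :
    ∃ b, m ≤ b ∧ l ≤ b ∧ b ^ l ≤ b := by
  refine ⟨max m 2 ^ l, (le_max_left m 2).trans (self_le_power _ (one_le_aleph0.trans hl)),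
    (cantor' l (Cardinal.one_lt_two.trans_le (le_max_right m 2))).le, ?_⟩
  rw [← power_mul, mul_eq_self hl]

namespace SCHAbove

variable {b l : Cardinal.{w}}

lemma power_le_succ (hb : SCHAbove b) (h₀ : ℵ₀ ≤ b) (hbl : b ^ l ≤ b) {κ : Cardinal.{w}}
    (hκ : b ≤ κ) : κ ^ l ≤ Order.succ κ := by
  induction κ using WellFoundedLT.induction with
  | ind κ ih =>
  have hκ₀ : ℵ₀ ≤ κ := h₀.trans hκ
  have power_le (c : Cardinal.{w}) (hc : c < κ) : c ^ l ≤ κ := by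
    rcases le_total c b with hcb | hcb
    · exact (power_le_power_right hcb).trans (hbl.trans hκ)
    · exact (ih c hc hcb).trans (Order.succ_le_of_lt hc)
  rcases lt_or_ge l κ.ord.cof with hl | hl
  · exact (power_le_self_of_lt_cof hκ₀ hl power_le).trans (Order.le_succ κ)
  · have two_power_le : 2 ^ κ.ord.cof ≤ κ :=
      calc 2 ^ κ.ord.cof ≤ 2 ^ l := power_le_power_left two_ne_zero hl
        _ ≤ b ^ l := power_le_power_right ((ofNat_lt_aleph0 (n := 2)).le.trans h₀)
        _ ≤ κ := hbl.trans hκ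
    calc κ ^ l ≤ κ ^ κ.ord.cof := power_le_power_cof hκ₀ power_le
      _ = 2 ^ κ.ord.cof + Order.succ κ := hb κ hκ₀ hκ
      _ ≤ Order.succ κ := add_le_of_le (hκ₀.trans (Order.le_succ κ))
        (two_power_le.trans (Order.le_succ κ)) le_rfl

lemma exists_power_le_self (hb : SCHAbove b) (h₀ : ℵ₀ ≤ b) (hl : ℵ₀ ≤ l) (hbl : b ^ l ≤ b)
    {μ c : Cardinal.{w}} (hμ : Order.IsSuccLimit μ) (hbμ : b < μ) (hc : c < μ) :
    ∃ χ, c ≤ χ ∧ χ < μ ∧ χ ^ l ≤ χ := by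
  refine ⟨max c b ^ l, (le_max_left c b).trans (self_le_power _ (one_le_aleph0.trans hl)),
    (hb.power_le_succ h₀ hbl (le_max_right c b)).trans_lt (hμ.succ_lt (max_lt hc hbμ)), ?_⟩
  rw [← power_mul, mul_eq_self hl]

end SCHAbove

end CardinalArithmetic

section DirectedHulls

open CardinalDirectedPoset

lemma hasCardinalLT_setCardinalLT_of_power_le {κ χ : Cardinal.{w}} (hχ : ℵ₀ ≤ χ) (h : χ ^ κ ≤ χ)
    {X : Type w} (hX : HasCardinalLT X (Order.succ χ)) :
    HasCardinalLT (SetCardinalLT κ X) (Order.succ χ) := by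
  rw [hasCardinalLT_iff_cardinal_mk_lt, Order.lt_succ_iff] at hX ⊢
  calc #(SetCardinalLT κ X) ≤ #{t : Set X // #t ≤ κ} :=
        mk_subtype_mono fun t ht ↦ ((hasCardinalLT_iff_cardinal_mk_lt _ _).1 ht).le
    _ ≤ max #X ℵ₀ ^ κ := mk_bounded_set_le X κ
    _ ≤ χ := (power_le_power_right (max_le hX hχ)).trans h

lemma exists_isCardinalFiltered_superset {κ χ : Cardinal.{w}} [Fact κ.IsRegular]
    (hκχ : κ ≤ χ) (h : χ ^ κ ≤ χ) {α : Type w} [PartialOrder α] [IsCardinalFiltered α κ]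
    {A : Set α} (hA : HasCardinalLT A (Order.succ χ)) :
    ∃ B : Set α, A ⊆ B ∧ IsCardinalFiltered B κ ∧ HasCardinalLT B (Order.succ χ) := by
  have hχ : ℵ₀ ≤ χ := (Fact.out : κ.IsRegular).aleph0_le.trans hκχ
  have : Fact (Order.succ χ).IsRegular := ⟨isRegular_succ hχ⟩
  exact SharplyLT.exists_isCardinalFiltered_set_of_exists_cofinal
    (hκχ.trans_lt (Order.lt_succ χ))
    (fun Y hY ↦ ⟨Set.univ, (hasCardinalLT_setCardinalLT_of_power_le hχ h hY).of_injective _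
      Subtype.val_injective, .univ⟩) A hA

end DirectedHulls

section GeneralizedElements

universe t

variable {C : Type u} [Category.{v} C]

/-- The generalized elements of `X` whose stage of definition belongs to the family `A`. Their
number is the notion of size of `X` on which the proof rests when the objects `A i` are dense. -/
abbrev GeneralizedElements {ι : Type t} (A : ι → C) (X : C) : Type (max t v) :=
  Σ i, A i ⟶ X

namespace GeneralizedElements

variable {ι : Type t} {A : ι → C} {X Y : C}

/-- The direct image of generalized elements under a morphism. -/
def map (f : X ⟶ Y) (x : GeneralizedElements A X) : GeneralizedElements A Y :=
  ⟨x.1, x.2 ≫ f⟩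

lemma map_map {Z : C} (f : X ⟶ Y) (g : Y ⟶ Z) (x : GeneralizedElements A X) :
    map g (map f x) = map (f ≫ g) x := by
  simp [map]

lemma map_id (x : GeneralizedElements A X) : map (𝟙 X) x = x := by
  simp [map]

variable {θ : Cardinal.{w}} [Fact θ.IsRegular] {J : Type w} [SmallCategory J]
  [IsCardinalFiltered J θ] {D : J ⥤ C} {c : Cocone D}

variable (θ) in
lemma exists_map_ι_eq [∀ i, IsCardinalPresentable (A i) θ] (hc : IsColimit c)
    (x : GeneralizedElements A c.pt) :
    ∃ (j : J) (y : GeneralizedElements A (D.obj j)), map (c.ι.app j) y = x := by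
  obtain ⟨j, f, hf⟩ := IsCardinalPresentable.exists_hom_of_isColimit θ hc x.2
  exact ⟨j, ⟨x.1, f⟩, Sigma.ext rfl (heq_of_eq hf)⟩

lemma exists_forall_map_ι_eq [∀ i, IsCardinalPresentable (A i) θ] (hc : IsColimit c)
    {T : Type w} (hT : HasCardinalLT T θ) (x : T → GeneralizedElements A c.pt) :
    ∃ (j : J) (y : T → GeneralizedElements A (D.obj j)), ∀ t, map (c.ι.app j) (y t) = x t := by
  choose j y hy using fun t ↦ exists_map_ι_eq θ hc (x t)
  refine ⟨IsCardinalFiltered.max j hT,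
    fun t ↦ map (D.map (IsCardinalFiltered.toMax j hT t)) (y t), fun t ↦ ?_⟩
  rw [map_map, c.w, hy]

lemma exists_not_hasCardinalLT [∀ i, IsCardinalPresentable (A i) θ] (hc : IsColimit c)
    {l : Cardinal.{w}} (hl : l < θ) (hX : ¬ HasCardinalLT (GeneralizedElements A c.pt) l) :
    ∃ j, ¬ HasCardinalLT (GeneralizedElements A (D.obj j)) l := by
  obtain ⟨e⟩ : Nonempty (ULift.{max t v} l.out ↪ ULift.{w} (GeneralizedElements A c.pt)) := by
    rw [← Cardinal.le_def, mk_uLift, mk_uLift, mk_out]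
    exact not_lt.1 hX
  let x (t : l.out) : GeneralizedElements A c.pt := (e ⟨t⟩).down
  have hx : Function.Injective x :=
    ULift.down_injective.comp (e.injective.comp ULift.up_injective)
  obtain ⟨j, y, hy⟩ := exists_forall_map_ι_eq hc
    (by rwa [hasCardinalLT_iff_cardinal_mk_lt, mk_out]) x
  have hy' : Function.Injective y := fun s t h ↦ hx (by rw [← hy, ← hy, h])
  refine ⟨j, fun h ↦ ?_⟩
  simpa [hasCardinalLT_iff_cardinal_mk_lt] using h.of_injective y hy'

end GeneralizedElements

lemma hasCardinalLT_arrow_costructuredArrow {B : Type t} [Category.{v} B] (F : B ⥤ C) [F.Faithful]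
    {X : C} {θ : Cardinal.{w}} [Fact θ.IsRegular]
    (hF : ∀ b, HasCardinalLT (GeneralizedElements F.obj (F.obj b)) θ)
    (hX : HasCardinalLT (GeneralizedElements F.obj X) θ) :
    HasCardinalLT (Arrow (CostructuredArrow F X)) θ := by
  have hB (b : B) : HasCardinalLT (Σ b', b' ⟶ b) θ :=
    (hF b).of_injective (Sigma.map id fun _ u ↦ F.map u)
      (Function.injective_id.sigma_map fun _ ↦ F.map_injective)
  let ofPair (x : Σ x : GeneralizedElements F.obj X, Σ b', b' ⟶ x.1) :
      Arrow (CostructuredArrow F X) :=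
    Arrow.mk (CostructuredArrow.mkPrecomp x.1.2 x.2.2)
  have exists_ofPair_eq {Y Z : CostructuredArrow F X} (a : Y ⟶ Z) :
      ∃ x, ofPair x = Arrow.mk a := by
    obtain ⟨b', ⟨⟨⟩⟩, f⟩ := Y
    obtain ⟨b, ⟨⟨⟩⟩, g⟩ := Z
    obtain ⟨(u : b' ⟶ b), r, hu⟩ := a
    obtain rfl : F.map u ≫ g = f := CostructuredArrow.w ⟨u, r, hu⟩
    exact ⟨⟨⟨b, g⟩, ⟨b', u⟩⟩, rfl⟩
  exact (hasCardinalLT_sigma _ θ hX fun x ↦ hB x.1).of_surjective ofPair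
    fun a ↦ exists_ofPair_eq a.hom

lemma isCardinalPresentable_of_hasCardinalLT_generalizedElements [LocallySmall.{w} C]
    {B : Type t} [Category.{v} B] (F : B ⥤ C) [F.Faithful] [F.IsDense]
    {θ : Cardinal.{w}} [Fact θ.IsRegular] [∀ b, IsCardinalPresentable (F.obj b) θ]
    (hF : ∀ b, HasCardinalLT (GeneralizedElements F.obj (F.obj b)) θ)
    {X : C} (hX : HasCardinalLT (GeneralizedElements F.obj X) θ) :
    IsCardinalPresentable X θ := by
  have harr := hasCardinalLT_arrow_costructuredArrow F hF hX
  have := harr.small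
  have := small_of_small_arrow.{w} (CostructuredArrow F X)
  have := locallySmall_of_small_arrow.{w} (CostructuredArrow F X)
  have : HasLimitsOfShape (CostructuredArrow F X)ᵒᵖ (Type w) :=
    hasLimitsOfShape_of_equivalence (equivSmallModel.{w} (CostructuredArrow F X)ᵒᵖ).symm
  have (a : CostructuredArrow F X) :
      IsCardinalPresentable ((CostructuredArrow.proj F X ⋙ F).obj a) θ :=
    inferInstanceAs (IsCardinalPresentable (F.obj a.left) θ)
  exact isCardinalPresentable_of_isColimit _ (F.denseAt X) θ harr

end GeneralizedElements

section ColimitsOverSubsets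

variable {C : Type u} [Category.{v} C] {α : Type w} [Preorder α]

/-- The colimit of the restriction of the diagram `D` to a set `s` of indices. -/
noncomputable def colimitOn (D : α ⥤ C) (s : Set α) [HasColimitsOfShape s C] : C :=
  colimit ((Subtype.mono_coe (· ∈ s)).functor ⋙ D)

namespace colimitOn

variable (D : α ⥤ C) (s : Set α) [HasColimitsOfShape s C]

/-- The coprojections of `colimitOn D s`. -/
noncomputable def ι (a : α) (ha : a ∈ s) : D.obj a ⟶ colimitOn D s :=
  colimit.ι ((Subtype.mono_coe (· ∈ s)).functor ⋙ D) ⟨a, ha⟩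

variable {s} in
lemma w {a b : α} (h : a ⟶ b) (ha : a ∈ s) (hb : b ∈ s) :
    D.map h ≫ ι D s b hb = ι D s a ha :=
  colimit.w ((Subtype.mono_coe (· ∈ s)).functor ⋙ D)
    (homOfLE (show (⟨a, ha⟩ : s) ≤ ⟨b, hb⟩ from leOfHom h))

variable {D s}

lemma hom_ext {X : C} {f g : colimitOn D s ⟶ X}
    (h : ∀ a ha, ι D s a ha ≫ f = ι D s a ha ≫ g) : f = g :=
  colimit.hom_ext fun a ↦ h a.1 a.2

/-- The morphism out of `colimitOn D s` induced by a compatible family of morphisms. -/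
noncomputable def desc {X : C} (φ : ∀ a ∈ s, D.obj a ⟶ X)
    (hφ : ∀ {a b : α} (h : a ⟶ b) (ha : a ∈ s) (hb : b ∈ s), D.map h ≫ φ b hb = φ a ha) :
    colimitOn D s ⟶ X :=
  colimit.desc ((Subtype.mono_coe (· ∈ s)).functor ⋙ D)
    { pt := X
      ι.app a := φ a.1 a.2
      ι.naturality a b h := (hφ (homOfLE (leOfHom h)) a.2 b.2).trans (Category.comp_id _).symm }

lemma ι_desc {X : C} (φ : ∀ a ∈ s, D.obj a ⟶ X)
    (hφ : ∀ {a b : α} (h : a ⟶ b) (ha : a ∈ s) (hb : b ∈ s), D.map h ≫ φ b hb = φ a ha)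
    (a : α) (ha : a ∈ s) : ι D s a ha ≫ desc φ hφ = φ a ha :=
  colimit.ι_desc _ (⟨a, ha⟩ : s)

variable {t : Set α} [HasColimitsOfShape t C]

variable (D) in
/-- The comparison morphism between the colimits over two nested sets of indices. -/
noncomputable def map (h : s ⊆ t) : colimitOn D s ⟶ colimitOn D t :=
  desc (fun a ha ↦ ι D t a (h ha)) fun f ha hb ↦ w D f (h ha) (h hb)

lemma ι_map (h : s ⊆ t) (a : α) (ha : a ∈ s) : ι D s a ha ≫ map D h = ι D t a (h ha) :=
  ι_desc _ (fun f ha hb ↦ w D f (h ha) (h hb)) a ha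

variable (s) in
/-- The morphism from `colimitOn D s` to the point of a cocone over all of `D`. -/
noncomputable def toPt (c : Cocone D) : colimitOn D s ⟶ c.pt :=
  desc (fun a _ ↦ c.ι.app a) fun h _ _ ↦ c.w h

lemma ι_toPt (c : Cocone D) (a : α) (ha : a ∈ s) : ι D s a ha ≫ toPt s c = c.ι.app a :=
  ι_desc _ (fun h _ _ ↦ c.w h) a ha

lemma map_toPt (c : Cocone D) (h : s ⊆ t) : map D h ≫ toPt t c = toPt s c :=
  hom_ext fun a ha ↦ by rw [← Category.assoc, ι_map, ι_toPt, ι_toPt]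

end colimitOn

section DirectedCover

variable {I : Type w} [Preorder I] (S : I →o Set α) [∀ i, HasColimitsOfShape (S i) C]

/-- The diagram of the colimits of `D` over the members of a monotone family of sets of
indices. -/
noncomputable abbrev colimitsOn (D : α ⥤ C) : I ⥤ C where
  obj i := colimitOn D (S i)
  map f := colimitOn.map D (S.monotone (leOfHom f))
  map_id i := colimitOn.hom_ext fun a ha ↦ by rw [colimitOn.ι_map, Category.comp_id]
  map_comp f g := colimitOn.hom_ext fun a ha ↦ by
    rw [← Category.assoc, colimitOn.ι_map, colimitOn.ι_map, colimitOn.ι_map]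

variable {D : α ⥤ C}

/-- The cocone over `colimitsOn S D` induced by a cocone over `D`. -/
noncomputable abbrev colimitsOnCocone (c : Cocone D) : Cocone (colimitsOn S D) where
  pt := c.pt
  ι.app i := colimitOn.toPt (S i) c
  ι.naturality _ _ f := (colimitOn.map_toPt c (S.monotone (leOfHom f))).trans
    (Category.comp_id _).symm

variable {S} [IsDirectedOrder I]

lemma ι_comp_leg_eq (s : Cocone (colimitsOn S D)) {a : α} {i j : I} (hi : a ∈ S i) (hj : a ∈ S j) :
    colimitOn.ι D (S i) a hi ≫ s.ι.app i = colimitOn.ι D (S j) a hj ≫ s.ι.app j := by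
  have along {i j : I} (hij : i ≤ j) (hi : a ∈ S i) :
      colimitOn.ι D (S i) a hi ≫ s.ι.app i =
        colimitOn.ι D (S j) a (S.monotone hij hi) ≫ s.ι.app j := by
    rw [← s.w (homOfLE hij), ← Category.assoc, colimitOn.ι_map]
  obtain ⟨k, hik, hjk⟩ := exists_ge_ge i j
  rw [along hik, along hjk]

/-- The cocone over `D` induced by a cocone over `colimitsOn S D`, the sets `S i` being directed
and covering all indices. -/
noncomputable abbrev coconeOfColimitsOn (hS : ∀ a, ∃ i, a ∈ S i) (s : Cocone (colimitsOn S D)) :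
    Cocone D where
  pt := s.pt
  ι.app a := colimitOn.ι D _ a (hS a).choose_spec ≫ s.ι.app (hS a).choose
  ι.naturality a b f := by
    obtain ⟨k, hak, hbk⟩ := exists_ge_ge (hS a).choose (hS b).choose
    have ha : a ∈ S k := S.monotone hak (hS a).choose_spec
    have hb : b ∈ S k := S.monotone hbk (hS b).choose_spec
    calc D.map f ≫ colimitOn.ι D _ b (hS b).choose_spec ≫ s.ι.app (hS b).choose
      _ = (D.map f ≫ colimitOn.ι D (S k) b hb) ≫ s.ι.app k := by
        rw [ι_comp_leg_eq s _ hb, Category.assoc]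
      _ = colimitOn.ι D _ a (hS a).choose_spec ≫ s.ι.app (hS a).choose := by
        rw [colimitOn.w D f ha, ι_comp_leg_eq s ha]
      _ = _ := (Category.comp_id _).symm

/-- A colimit is the colimit of the colimits over the members of a directed cover of the
indices. -/
noncomputable def isColimitColimitsOnCocone (hS : ∀ a, ∃ i, a ∈ S i) {c : Cocone D}
    (hc : IsColimit c) : IsColimit (colimitsOnCocone S c) where
  desc s := hc.desc (coconeOfColimitsOn hS s)
  fac s i := colimitOn.hom_ext fun a ha ↦ by
    dsimp only
    rw [← Category.assoc, colimitOn.ι_toPt, hc.fac]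
    exact ι_comp_leg_eq s _ ha
  uniq s m hm := hc.uniq (coconeOfColimitsOn hS s) m fun a ↦
    calc c.ι.app a ≫ m
      _ = colimitOn.ι D _ a (hS a).choose_spec ≫ colimitOn.toPt _ c ≫ m := by
        rw [← Category.assoc, colimitOn.ι_toPt]
      _ = (coconeOfColimitsOn hS s).ι.app a := congr_arg (_ ≫ ·) (hm _)

end DirectedCover

end ColimitsOverSubsets

section SmallSubcolimits

universe t

variable {C : Type u} [Category.{v} C] {α : Type w} [Preorder α]

lemma GeneralizedElements.exists_map_colimitOn_ι_eq (κ : Cardinal.{w}) [Fact κ.IsRegular]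
    {ι : Type t} {A : ι → C} [∀ i, IsCardinalPresentable (A i) κ] {D : α ⥤ C} {s : Set α}
    [IsCardinalFiltered s κ] [HasColimitsOfShape s C] (x : GeneralizedElements A (colimitOn D s)) :
    ∃ (a : s) (y : GeneralizedElements A (D.obj a)), map (colimitOn.ι D s a a.2) y = x :=
  exists_map_ι_eq κ (colimit.isColimit ((Subtype.mono_coe (· ∈ s)).functor ⋙ D)) x

variable {κ θ : Cardinal.{w}} [Fact κ.IsRegular] [Fact θ.IsRegular]
  [HasCardinalFilteredColimits C κ]

lemma exists_comp_toPt_eq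
    (hα : ∀ A : Set α, HasCardinalLT A θ →
      ∃ B : Set α, A ⊆ B ∧ IsCardinalFiltered B κ ∧ HasCardinalLT B θ)
    {D : α ⥤ C} {c : Cocone D} (hc : IsColimit c) {X : C} [IsCardinalPresentable X θ]
    (f : X ⟶ c.pt) :
    ∃ (B : Set α) (_ : IsCardinalFiltered B κ) (_ : HasColimitsOfShape B C)
      (g : X ⟶ colimitOn D B), HasCardinalLT B θ ∧ g ≫ colimitOn.toPt B c = f := by
  let I := {B : Set α // IsCardinalFiltered B κ ∧ HasCardinalLT B θ}
  let S : I →o Set α := ⟨Subtype.val, fun _ _ h ↦ h⟩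
  have (i : I) : HasColimitsOfShape (S i) C :=
    have := i.2.1
    HasCardinalFilteredColimits.hasColimitsOfShape (κ := κ) C i.1
  have hθ : ℵ₀ ≤ θ := (Fact.out : θ.IsRegular).aleph0_le
  have : IsCardinalFiltered I θ := isCardinalFiltered_preorder _ _ fun K i hK ↦
    have ⟨B, hB, hB'⟩ := hα (⋃ k, (i k).1) (hasCardinalLT_iUnion _
      (by rwa [hasCardinalLT_iff_cardinal_mk_lt]) fun k ↦ (i k).2.2)
    ⟨⟨B, hB'⟩, fun k ↦ (Set.subset_iUnion (fun k ↦ (i k).1) k).trans hB⟩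
  have := isFiltered_of_isCardinalFiltered I θ
  have := IsFiltered.isDirectedOrder I
  have hS (a : α) : ∃ i, a ∈ S i :=
    have ⟨B, hB, hB'⟩ := hα {a} (hasCardinalLT_of_finite _ _ hθ)
    ⟨⟨B, hB'⟩, hB rfl⟩
  obtain ⟨i, g, hg⟩ := IsCardinalPresentable.exists_hom_of_isColimit θ
    (isColimitColimitsOnCocone hS hc) f
  exact ⟨S i, i.2.1, inferInstance, g, i.2.2, hg⟩

namespace GeneralizedElements

variable {ι : Type t} {A : ι → C} [∀ i, IsCardinalPresentable (A i) κ]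

lemma hasCardinalLT_of_directed
    (hα : ∀ A : Set α, HasCardinalLT A θ →
      ∃ B : Set α, A ⊆ B ∧ IsCardinalFiltered B κ ∧ HasCardinalLT B θ)
    {D : α ⥤ C} (hD : ∀ a, HasCardinalLT (GeneralizedElements A (D.obj a)) θ)
    {c : Cocone D} (hc : IsColimit c) [IsCardinalPresentable c.pt θ] :
    HasCardinalLT (GeneralizedElements A c.pt) θ := by
  obtain ⟨B, _, _, r, hB, hr⟩ := exists_comp_toPt_eq hα hc (𝟙 c.pt)
  refine (hasCardinalLT_sigma _ θ hB fun a ↦ hD a.1).of_surjective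
    (fun y ↦ map (c.ι.app y.1.1) y.2) fun x ↦ ?_
  obtain ⟨a, y, hy⟩ := exists_map_colimitOn_ι_eq κ (map r x)
  refine ⟨⟨a, y⟩, ?_⟩
  calc map (c.ι.app a.1) y
    _ = map (colimitOn.toPt B c) (map (colimitOn.ι D B a a.2) y) := by
      rw [map_map, colimitOn.ι_toPt]
    _ = x := by rw [hy, map_map, hr, map_id]

lemma hasCardinalLT_succ {χ : Cardinal.{w}} [Fact (Order.succ χ).IsRegular]
    (hκχ : κ ≤ χ) (hχ : χ ^ κ ≤ χ) {J : Type w} [SmallCategory J] [IsCardinalFiltered J κ]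
    {D : J ⥤ C} (hD : ∀ j, HasCardinalLT (GeneralizedElements A (D.obj j)) (Order.succ χ))
    {c : Cocone D} (hc : IsColimit c) [IsCardinalPresentable c.pt (Order.succ χ)] :
    HasCardinalLT (GeneralizedElements A c.pt) (Order.succ χ) := by
  obtain ⟨α, _, _, F, _⟩ := IsCardinalFiltered.exists_cardinal_directed J κ
  have : IsCardinalPresentable (c.whisker F).pt (Order.succ χ) := ‹_›
  exact hasCardinalLT_of_directed (κ := κ)
    (fun _ hA ↦ exists_isCardinalFiltered_superset hκχ hχ hA) (fun a ↦ hD (F.obj a))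
    ((Functor.Final.isColimitWhiskerEquiv F c).symm hc)

end GeneralizedElements

end SmallSubcolimits

section Chains

variable {C : Type u} [Category.{v} C]

lemma isIso_left_of_isIso_comp {X Y Z : C} (f : X ⟶ Y) (g : Y ⟶ Z) [Mono g] [IsIso (f ≫ g)] :
    IsIso f := by
  have : IsSplitEpi g := ⟨⟨⟨inv (f ≫ g) ≫ f, by simp⟩⟩⟩
  have : IsIso g := isIso_of_mono_of_isSplitEpi g
  exact IsIso.of_isIso_comp_right f g

lemma exists_isEventuallyConstantFrom [∀ (X Y : C) (f : X ⟶ Y), Mono f] (κ : Cardinal.{w})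
    [Fact κ.IsRegular] {J : Type w} [SmallCategory J] [IsCardinalFiltered J κ] {D : J ⥤ C}
    {c : Cocone D} (hc : IsColimit c) (h : IsCardinalPresentable c.pt κ) :
    ∃ j, D.IsEventuallyConstantFrom j := by
  obtain ⟨j, r, hr⟩ := IsCardinalPresentable.exists_hom_of_isColimit κ hc (𝟙 c.pt)
  have : IsSplitEpi (c.ι.app j) := ⟨⟨⟨r, hr⟩⟩⟩
  have : IsIso (c.ι.app j) := isIso_of_mono_of_isSplitEpi _
  refine ⟨j, fun k f ↦ ?_⟩
  have : IsIso (D.map f ≫ c.ι.app k) := by rwa [c.w]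
  exact isIso_left_of_isIso_comp (D.map f) (c.ι.app k)

lemma exists_monotone_forall_lt_le {κ : Cardinal.{w}} [Fact κ.IsRegular] {α : Type w} [Preorder α]
    [IsCardinalFiltered α κ] (e : α → α) (he : ∀ a, a ≤ e a) :
    ∃ f : κ.ord.ToType → α, Monotone f ∧ ∀ a b, b < a → e (f b) ≤ f a := by
  have hlt (a : κ.ord.ToType) : HasCardinalLT (Set.Iio a) κ := by
    simpa [hasCardinalLT_iff_cardinal_mk_lt] using mk_Iio_lt a
  let f : κ.ord.ToType → α := wellFounded_lt.fix fun a ih ↦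
    IsCardinalFiltered.max (fun b : Set.Iio a ↦ e (ih b.1 b.2)) (hlt a)
  have f_eq (a : κ.ord.ToType) :
      f a = IsCardinalFiltered.max (fun b : Set.Iio a ↦ e (f b.1)) (hlt a) :=
    WellFounded.fix_eq _ _ _
  have hf (a b : κ.ord.ToType) (hab : b < a) : e (f b) ≤ f a := by
    rw [f_eq a]
    exact leOfHom (IsCardinalFiltered.toMax (fun b : Set.Iio a ↦ e (f b.1)) (hlt a) ⟨b, hab⟩)
  exact ⟨f, monotone_iff_forall_lt.2 fun b a hba ↦ (he _).trans (hf a b hba), hf⟩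

lemma exists_monotone_not_isEventuallyConstantFrom [∀ (X Y : C) (f : X ⟶ Y), Mono f]
    (κ : Cardinal.{w}) [Fact κ.IsRegular] {α : Type w} [Preorder α] [IsCardinalFiltered α κ]
    {D : α ⥤ C} (hD : ∀ a, ¬ D.IsEventuallyConstantFrom a) :
    ∃ (f : κ.ord.ToType → α) (hf : Monotone f),
      ∀ a, ¬ (hf.functor ⋙ D).IsEventuallyConstantFrom a := by
  simp only [Functor.IsEventuallyConstantFrom, not_forall] at hD
  choose e φ he using hD
  obtain ⟨f, hf, hef⟩ := exists_monotone_forall_lt_le (κ := κ) e fun a ↦ leOfHom (φ a)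
  refine ⟨f, hf, fun a ha ↦ he (f a) ?_⟩
  have : NoMaxOrder κ.ord.ToType := noMaxOrder (Fact.out : κ.IsRegular).aleph0_le
  obtain ⟨b, hab⟩ := exists_gt a
  have : IsIso (D.map (φ (f a)) ≫ D.map (homOfLE (hef b a hab))) := by
    rw [← Functor.map_comp]
    exact ha (homOfLE hab.le)
  exact isIso_left_of_isIso_comp _ (D.map (homOfLE (hef b a hab)))

lemma hasCardinalLT_arrow_of_preorder {α : Type w} [Preorder α] {θ : Cardinal.{w}} (hθ : ℵ₀ ≤ θ)
    (h : HasCardinalLT α θ) : HasCardinalLT (Arrow α) θ :=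
  (hasCardinalLT_prod hθ h h).of_injective (fun a ↦ (a.left, a.right)) fun a b hab ↦ by
    obtain ⟨_, _, _⟩ := a
    obtain ⟨_, _, _⟩ := b
    cases hab
    exact congr_arg Arrow.mk (Subsingleton.elim (α := (_ : α) ⟶ _) _ _)

lemma exists_isCardinalPresentable_succ_and_not [∀ (X Y : C) (f : X ⟶ Y), Mono f]
    [LocallySmall.{w} C] {μ : Cardinal.{w}} [Fact μ.IsRegular] [Fact (Order.succ μ).IsRegular]
    [HasCardinalFilteredColimits C μ] {J : Type w} [SmallCategory J]
    [IsCardinalFiltered J (Order.succ μ)] {D : J ⥤ C}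
    [∀ j, IsCardinalPresentable (D.obj j) (Order.succ μ)] {c : Cocone D} (hc : IsColimit c)
    (hN : ¬ IsCardinalPresentable c.pt (Order.succ μ)) :
    ∃ M : C, IsCardinalPresentable M (Order.succ μ) ∧ ¬ IsCardinalPresentable M μ := by
  obtain ⟨α, _, _, F, _⟩ := IsCardinalFiltered.exists_cardinal_directed J (Order.succ μ)
  have := isFiltered_of_isCardinalFiltered α (Order.succ μ)
  have : IsCardinalFiltered α μ := .of_le α (Order.le_succ μ)
  have hD (a : α) : ¬ (F ⋙ D).IsEventuallyConstantFrom a := fun ha ↦ by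
    have : IsIso (c.ι.app (F.obj a)) :=
      ha.isIso_ι_of_isColimit ((Functor.Final.isColimitWhiskerEquiv F c).symm hc)
    exact hN (isCardinalPresentable_of_iso (asIso (c.ι.app (F.obj a))) _)
  obtain ⟨f, hf, hfD⟩ := exists_monotone_not_isEventuallyConstantFrom μ hD
  have := HasCardinalFilteredColimits.hasColimitsOfShape (κ := μ) C μ.ord.ToType
  have (a : μ.ord.ToType) : IsCardinalPresentable ((hf.functor ⋙ F ⋙ D).obj a) (Order.succ μ) :=
    inferInstanceAs (IsCardinalPresentable (D.obj (F.obj (f a))) _)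
  have harrow : HasCardinalLT (Arrow μ.ord.ToType) (Order.succ μ) :=
    hasCardinalLT_arrow_of_preorder (IsRegular.aleph0_le Fact.out)
      (by simp [hasCardinalLT_iff_cardinal_mk_lt])
  refine ⟨colimit (hf.functor ⋙ F ⋙ D),
    isCardinalPresentable_of_isColimit _ (colimit.isColimit _) _ harrow, fun h ↦ ?_⟩
  obtain ⟨a, ha⟩ := exists_isEventuallyConstantFrom μ (colimit.isColimit _) h
  exact hfD a ha

end Chains

section ExistenceOfRank

variable {K : Type u} [Category.{v} K]

lemma hasPresentabilityRank_succ {M : K} {μ : Cardinal.{w}} [hμ : Fact (Order.succ μ).IsRegular]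
    [hM : IsCardinalPresentable M (Order.succ μ)]
    (h : ∀ (κ : Cardinal.{w}) [Fact κ.IsRegular], κ ≤ μ → ¬ IsCardinalPresentable M κ) :
    HasPresentabilityRank M (Order.succ μ) :=
  ⟨⟨hμ, hM⟩, fun κ ⟨_, hκ⟩ ↦ not_lt.1 fun hlt ↦ h κ (Order.lt_succ_iff.1 hlt) hκ⟩

lemma IsLargeCategory.exists_not_isCardinalPresentable (hK : IsLargeCategory.{w} K)
    (θ : Cardinal.{w}) [Fact θ.IsRegular] [IsCardinalAccessibleCategory K θ] :
    ∃ X : K, ¬ IsCardinalPresentable X θ := by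
  by_contra! h
  obtain ⟨P, _, -, hP⟩ := ObjectProperty.EssentiallySmall.exists_small_le.{w}
    (isCardinalPresentable K θ)
  refine hK (small_of_surjective (α := Subtype P)
    (f := fun A ↦ Quotient.mk (isIsomorphicSetoid K) A.1) fun x ↦ ?_)
  induction x using Quotient.inductionOn with
  | h X =>
    obtain ⟨A, hA, ⟨i⟩⟩ := hP X (h X)
    exact ⟨⟨A, hA⟩, Quotient.sound ⟨i.symm⟩⟩

lemma hasCardinalFilteredColimits_of_le {κ θ : Cardinal.{w}} [Fact κ.IsRegular]
    [Fact θ.IsRegular] [HasCardinalFilteredColimits K κ] (h : κ ≤ θ) :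
    HasCardinalFilteredColimits K θ where
  hasColimitsOfShape J _ _ :=
    have : IsCardinalFiltered J κ := .of_le J h
    HasCardinalFilteredColimits.hasColimitsOfShape (κ := κ) K J

lemma isDense_ι_of_isCardinalPresentable_le_isoClosure {κ : Cardinal.{w}} [Fact κ.IsRegular]
    [IsCardinalAccessibleCategory K κ] {P : ObjectProperty K}
    (hP : P ≤ isCardinalPresentable K κ) (hP' : isCardinalPresentable K κ ≤ P.isoClosure) :
    P.ι.IsDense := by
  have : (ObjectProperty.ιOfLE hP).IsEquivalence :=
    (ObjectProperty.isEquivalence_ιOfLE_iff hP).2 hP'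
  exact inferInstanceAs (ObjectProperty.ιOfLE hP ⋙ (isCardinalPresentable K κ).ι).IsDense

lemma exists_hasPresentabilityRank_succ_of_isRegular [∀ (X Y : K) (f : X ⟶ Y), Mono f]
    {μ : Cardinal.{w}} [Fact μ.IsRegular] [Fact (Order.succ μ).IsRegular]
    [HasCardinalFilteredColimits K μ] [IsCardinalAccessibleCategory K (Order.succ μ)]
    {X : K} (hX : ¬ IsCardinalPresentable X (Order.succ μ)) :
    ∃ M : K, HasPresentabilityRank M (Order.succ μ) := by
  obtain ⟨J, _, _, ⟨p⟩⟩ := (isCardinalFilteredGenerator_isCardinalPresentable K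
    (Order.succ μ)).exists_colimitsOfShape X
  have (j : J) : IsCardinalPresentable (p.diag.obj j) (Order.succ μ) := p.prop_diag_obj j
  obtain ⟨M, _, hM⟩ := exists_isCardinalPresentable_succ_and_not p.isColimit hX
  exact ⟨M, hasPresentabilityRank_succ fun κ _ hκ _ ↦ hM (isCardinalPresentable_of_le M hκ)⟩

variable {κ : Cardinal.{w}} [Fact κ.IsRegular] [IsCardinalAccessibleCategory K κ]
  {P : ObjectProperty K}

lemma hasCardinalLT_generalizedElements_of_isCardinalPresentable
    (hP : P.IsCardinalFilteredGenerator κ) {χ l : Cardinal.{w}} [Fact l.IsRegular]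
    (hκχ : κ ≤ χ) (hχ : χ ^ κ ≤ χ) (hlχ : l ≤ χ)
    (hPχ : ∀ B : P.FullSubcategory,
      HasCardinalLT (GeneralizedElements P.ι.obj B.obj) (Order.succ χ))
    (X : K) [IsCardinalPresentable X l] :
    HasCardinalLT (GeneralizedElements P.ι.obj X) (Order.succ χ) := by
  obtain ⟨J, _, _, ⟨p⟩⟩ := hP.exists_colimitsOfShape X
  have : Fact (Order.succ χ).IsRegular :=
    ⟨isRegular_succ ((Fact.out : κ.IsRegular).aleph0_le.trans hκχ)⟩
  have : IsCardinalPresentable X (Order.succ χ) :=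
    isCardinalPresentable_of_le X (hlχ.trans (Order.le_succ χ))
  have (B : P.FullSubcategory) : IsCardinalPresentable (P.ι.obj B) κ :=
    hP.le_isCardinalPresentable _ B.property
  exact GeneralizedElements.hasCardinalLT_succ hκχ hχ
    (fun j ↦ hPχ ⟨_, p.prop_diag_obj j⟩) p.isColimit

lemma exists_hasPresentabilityRank_succ_of_isSingular [P.ι.IsDense]
    (hP : P.IsCardinalFilteredGenerator κ) {b μ : Cardinal.{w}} (hκb : κ ≤ b)
    (hPb : ∀ B : P.FullSubcategory, HasCardinalLT (GeneralizedElements P.ι.obj B.obj) b)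
    (hbμ : b < μ) (hμ : μ.IsSingular)
    (hpow : ∀ c < μ, ∃ χ, c ≤ χ ∧ χ < μ ∧ χ ^ κ ≤ χ)
    [Fact (Order.succ μ).IsRegular] [IsCardinalAccessibleCategory K (Order.succ μ)]
    {X : K} (hX : ¬ IsCardinalPresentable X (Order.succ μ)) :
    ∃ M : K, HasPresentabilityRank M (Order.succ μ) := by
  have hbμ' : b ≤ Order.succ μ := hbμ.le.trans (Order.le_succ μ)
  have (B : P.FullSubcategory) : IsCardinalPresentable (P.ι.obj B) (Order.succ μ) :=
    isCardinalPresentable_monotone K (hκb.trans hbμ') _ (hP.le_isCardinalPresentable _ B.property)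
  have hX' : ¬ HasCardinalLT (GeneralizedElements P.ι.obj X) μ := fun h ↦
    hX (isCardinalPresentable_of_hasCardinalLT_generalizedElements P.ι
      (fun B ↦ (hPb B).of_le hbμ') (h.of_le (Order.le_succ μ)))
  obtain ⟨J, _, _, ⟨p⟩⟩ := (isCardinalFilteredGenerator_isCardinalPresentable K
    (Order.succ μ)).exists_colimitsOfShape X
  obtain ⟨j, hj⟩ :=
    GeneralizedElements.exists_not_hasCardinalLT p.isColimit (Order.lt_succ μ) hX'
  have : IsCardinalPresentable (p.diag.obj j) (Order.succ μ) := p.prop_diag_obj j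
  refine ⟨p.diag.obj j, hasPresentabilityRank_succ fun l hl hlμ _ ↦ hj ?_⟩
  have hlμ' : l < μ := hlμ.lt_of_ne fun h ↦ hμ.not_isRegular (h ▸ hl.out)
  obtain ⟨χ, hχ, hχμ, hχκ⟩ := hpow (max l b) (max_lt hlμ' hbμ)
  have hbχ : b ≤ χ := (le_max_right l b).trans hχ
  exact (hasCardinalLT_generalizedElements_of_isCardinalPresentable hP (hκb.trans hbχ) hχκ
    ((le_max_left l b).trans hχ) (fun B ↦ (hPb B).of_le (hbχ.trans (Order.le_succ χ)))
    (p.diag.obj j)).of_le (Order.succ_le_of_lt hχμ)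

lemma exists_dense_isCardinalFilteredGenerator (K : Type u) [Category.{v} K] (κ : Cardinal.{w})
    [Fact κ.IsRegular] [IsCardinalAccessibleCategory K κ] :
    ∃ (P : ObjectProperty K) (b : Cardinal.{w}), P.ι.IsDense ∧ P.IsCardinalFilteredGenerator κ ∧
      ∀ B : P.FullSubcategory, HasCardinalLT (GeneralizedElements P.ι.obj B.obj) b := by
  obtain ⟨P, _, hle, hle'⟩ := ObjectProperty.EssentiallySmall.exists_small_le.{w}
    (isCardinalPresentable K κ)
  obtain ⟨b, -, hb⟩ := HasCardinalLT.exists_regular_cardinal_forall.{w}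
    fun B : P.FullSubcategory ↦ GeneralizedElements P.ι.obj B.obj
  exact ⟨P, b, isDense_ι_of_isCardinalPresentable_le_isoClosure hle hle',
    (isCardinalFilteredGenerator_isCardinalPresentable K κ).of_le_isoClosure hle' hle, hb⟩

end ExistenceOfRank

theorem mainTheorem3 (hESCH : ESCH.{w}) (K : Type u) [Category.{v} K]
    (hlarge : IsLargeCategory.{w} K)
    (hmono : ∀ (X Y : K) (f : X ⟶ Y), Mono f) :
    ∃ θ₀ : Cardinal.{w}, ∀ θ : Cardinal.{w}, θ₀ ≤ θ →
      (∃ μ : Cardinal.{w}, θ = Order.succ μ) →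
      θ ∈ accessibilitySpectrum.{w} K → θ ∈ existenceSpectrum.{w} K := by
  by_cases hacc : ∃ κ : Cardinal.{w}, κ ∈ accessibilitySpectrum.{w} K
  swap
  · exact ⟨0, fun θ _ _ hθ ↦ (hacc ⟨θ, hθ⟩).elim⟩
  obtain ⟨κ, hκ, _⟩ := hacc
  obtain ⟨s, hs⟩ := hESCH
  obtain ⟨P, b₀, _, hP, hP₀⟩ := exists_dense_isCardinalFilteredGenerator K κ
  obtain ⟨b, hsb, hκb, hbκ⟩ := exists_le_power_le_self (max s b₀) hκ.out.aleph0_le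
  have hb : SCHAbove b := fun c hc hbc ↦ hs c hc ((le_max_left s b₀).trans (hsb.trans hbc))
  have hb₀ : ℵ₀ ≤ b := hκ.out.aleph0_le.trans hκb
  refine ⟨Order.succ (Order.succ b), ?_⟩
  rintro _ hθ ⟨μ, rfl⟩ ⟨_, _⟩
  have hbμ : b < μ := Order.succ_le_iff.1 (Order.succ_le_succ_iff.1 hθ)
  obtain ⟨X, hX⟩ := hlarge.exists_not_isCardinalPresentable (Order.succ μ)
  rcases isRegular_or_isSingular (hb₀.trans hbμ.le) with hreg | hsing
  · have : Fact μ.IsRegular := ⟨hreg⟩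
    have : HasCardinalFilteredColimits K μ :=
      hasCardinalFilteredColimits_of_le (hκb.trans hbμ.le)
    exact exists_hasPresentabilityRank_succ_of_isRegular hX
  · exact exists_hasPresentabilityRank_succ_of_isSingular hP hκb
      (fun B ↦ (hP₀ B).of_le ((le_max_right s b₀).trans hsb)) hbμ hsing
      (fun c ↦ hb.exists_power_le_self hb₀ hκ.out.aleph0_le hbκ hsing.isSuccLimit hbμ) hX
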